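/- Let $\mathcal H,\mathcal K$ be infinite-dimensional separable complex Hilbert spaces, and let $A$ (in $\mathcal H$) and $D$ (in $\mathcal K$) be closed, densely defined linear operators. For a linear operator $S$ in a Hilbert space $\mathcal X$ with domain $\mathcal D(S)$, write $\mathcal R(S)$ for its range, $\alpha(S)=\dim\mathcal N(S)$ for the dimension of its kernel and $\beta(S)=\dim \mathcal X/\mathcal R(S)$, both in $\{0,1,2,\dots\}\cup\{\infty\}$. A closed, densely defined operator $S$ is upper semi-Fredholm if $\alpha(S)<\infty$ and $\mathcal R(S)$ is closed, and upper semi-Weyl if in addition $\alpha(S)-\beta(S)\le 0$. Let $\mathcal C^+_D(\mathcal K,\mathcal H)$ be the set of all closable linear operators $B$ from $\mathcal K$ to $\mathcal H$ with $\mathcal D(D)\subset\mathcal D(B)$, and for such $B$ let $$T_B=\begin{pmatrix}A&B\\0&D\end{pmatrix}:\ \mathcal D(A)\oplus\mathcal D(D)\subset\mathcal H\oplus\mathcal K\to\mathcal H\oplus\mathcal K .$$ Then there exists $B\in\mathcal C^+_D(\mathcal K,\mathcal H)$ such that $T_B$ is upper semi-Weyl if and only if $A$ is upper semi-Fredholm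 and the following holds: - if $\mathcal R(D)$ is closed, then either $\alpha(D)<\infty$ and $\alpha(A)+\alpha(D)\le\beta(A)+\beta(D)$, or $\beta(A)=\alpha(D)=\infty$; - if $\mathcal R(D)$ is not closed, then $\beta(A)=\infty$. -/

import Mathlib

/-- The null space `N(T)` of a partially defined operator, as a subspace of the ambient space. -/
def opKer {E F : Type*} [NormedAddCommGroup E] [NormedSpace ℂ E]
    [NormedAddCommGroup F] [NormedSpace ℂ F] (T : E →ₗ.[ℂ] F) : Submodule ℂ E :=
  (LinearMap.ker T.toFun).map T.domain.subtype

/-- The range `R(T)` of a partially defined operator. -/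
def opRange {E F : Type*} [NormedAddCommGroup E] [NormedSpace ℂ E]
    [NormedAddCommGroup F] [NormedSpace ℂ F] (T : E →ₗ.[ℂ] F) : Submodule ℂ F :=
  LinearMap.range T.toFun

/-- `α(T) = dim N(T)`, with value `⊤` when the dimension is infinite. -/
noncomputable def opAlpha {E F : Type*} [NormedAddCommGroup E] [NormedSpace ℂ E]
    [NormedAddCommGroup F] [NormedSpace ℂ F] (T : E →ₗ.[ℂ] F) : ℕ∞ :=
  Cardinal.toENat (Module.rank ℂ (opKer T))

/-- `β(T) = dim (F ⧸ R(T))`, with value `⊤` when the dimension is infinite. -/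
noncomputable def opBeta {E F : Type*} [NormedAddCommGroup E] [NormedSpace ℂ E]
    [NormedAddCommGroup F] [NormedSpace ℂ F] (T : E →ₗ.[ℂ] F) : ℕ∞ :=
  Cardinal.toENat (Module.rank ℂ (F ⧸ opRange T))

/-- `ind(T) = α(T) - β(T)`, as an extended real number. It is only used for operators with
`α(T) < ∞`, where the difference is meaningful. -/
noncomputable def opInd {E F : Type*} [NormedAddCommGroup E] [NormedSpace ℂ E]
    [NormedAddCommGroup F] [NormedSpace ℂ F] (T : E →ₗ.[ℂ] F) : EReal :=
  (((opAlpha T : ℕ∞) : ENNReal) : EReal) - (((opBeta T : ℕ∞) : ENNReal) : EReal)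

/-- Upper semi-Fredholm: closed, densely defined, finite-dimensional kernel and closed range. -/
structure IsUpperSemiFredholm {E F : Type*} [NormedAddCommGroup E] [NormedSpace ℂ E]
    [NormedAddCommGroup F] [NormedSpace ℂ F] (T : E →ₗ.[ℂ] F) : Prop where
  closed : T.IsClosed
  dense : Dense (T.domain : Set E)
  alpha_lt_top : opAlpha T < ⊤
  closed_range : IsClosed (opRange T : Set F)

/-- Upper semi-Weyl: upper semi-Fredholm with `ind(T) ≤ 0`. -/
structure IsUpperSemiWeyl {E F : Type*} [NormedAddCommGroup E] [NormedSpace ℂ E]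
    [NormedAddCommGroup F] [NormedSpace ℂ F] (T : E →ₗ.[ℂ] F) : Prop where
  upperSemiFredholm : IsUpperSemiFredholm T
  ind_nonpos : opInd T ≤ 0

/-- `C⁺_D(K, H)`: the closable operators from `K` to `H` whose domain contains the domain
of `D`. -/
def closableOver {H K : Type*} [NormedAddCommGroup H] [NormedSpace ℂ H]
    [NormedAddCommGroup K] [NormedSpace ℂ K] (D : K →ₗ.[ℂ] K) : Set (K →ₗ.[ℂ] H) :=
  {B | B.IsClosable ∧ D.domain ≤ B.domain}

/-- The operator matrix `[A B; 0 D]` in the Hilbert space direct sum of `H` and `K`, with the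
diagonal domain `D(A) ⊕ D(D)`: it sends `(x, y)` to `(A x + B y, D y)`. -/
noncomputable def upperTriangular {H K : Type*} [NormedAddCommGroup H] [NormedSpace ℂ H]
    [NormedAddCommGroup K] [NormedSpace ℂ K]
    (A : H →ₗ.[ℂ] H) (B : K →ₗ.[ℂ] H) (D : K →ₗ.[ℂ] K) (hB : D.domain ≤ B.domain) :
    WithLp 2 (H × K) →ₗ.[ℂ] WithLp 2 (H × K) where
  domain :=
    { carrier := {p | p.fst ∈ A.domain ∧ p.snd ∈ D.domain}
      add_mem' := fun hp hq => ⟨A.domain.add_mem hp.1 hq.1, D.domain.add_mem hp.2 hq.2⟩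
      zero_mem' := ⟨A.domain.zero_mem, D.domain.zero_mem⟩
      smul_mem' := fun c _ hp => ⟨A.domain.smul_mem c hp.1, D.domain.smul_mem c hp.2⟩ }
  toFun :=
    { toFun := fun p => WithLp.toLp 2
        (A ⟨p.1.fst, p.2.1⟩ + B ⟨p.1.snd, hB p.2.2⟩, D ⟨p.1.snd, p.2.2⟩)
      map_add' := by
        rintro ⟨p, hp⟩ ⟨q, hq⟩
        have h1 := A.map_add ⟨p.fst, hp.1⟩ ⟨q.fst, hq.1⟩
        have h2 := B.map_add ⟨p.snd, hB hp.2⟩ ⟨q.snd, hB hq.2⟩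
        have h3 := D.map_add ⟨p.snd, hp.2⟩ ⟨q.snd, hq.2⟩
        rw [← WithLp.toLp_add, Prod.mk_add_mk, ← h3, add_add_add_comm, ← h1, ← h2]
        rfl
      map_smul' := by
        rintro c ⟨p, hp⟩
        have h1 := A.map_smul c ⟨p.fst, hp.1⟩
        have h2 := B.map_smul c ⟨p.snd, hB hp.2⟩
        have h3 := D.map_smul c ⟨p.snd, hp.2⟩
        rw [RingHom.id_apply, ← WithLp.toLp_smul, Prod.smul_mk, ← h3, smul_add, ← h1, ← h2]
        rfl }

/-! For `T = T_B`, compare kernels and cokernels through the connecting map `δ : ker D → coker A`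
induced by `B`. There are exact sequences `0 → ker A → ker T → ker δ → 0` and `0 → coker δ → coker T
→ coker D → 0`. All dimension statements come from these, as equations between sums in `ℕ∞`, so no
infinite quantity is ever subtracted.

Necessity: `R(A) ⊕ 0` is the image of the closed subspace `H ⊕ 0` under the semi-Fredholm `T`, hence
closed. If `β(A) < ∞`, then `δ` has finite rank, which yields the inequality, and adding a
finite-dimensional space to `R(T)` gives `H ⊕ R(D)`, so `R(D)` is closed.

Sufficiency: if `R(D)` is closed and `α(D) < ∞`, take `B = 0`. Otherwise `β(A) = ∞`, and `B` is a
bounded embedding of `K` into the orthogonal complement of `R(A)` that leaves infinite codimension.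
The second component of the argument can then be read off the first component of the value, so
neither the kernel nor the range of `D` matters. -/

/-! ### Algebraic dimension count. -/

open Module in
/-- Dimension count for the block upper triangular map `(x, y) ↦ (A x + B y, D y)`: `k` and `r` are
the dimensions of the kernel and the range of the connecting map `ker D → coker A` induced by `B`,
and `c` is the codimension of its range. -/
theorem exists_length_blockTriangular {X Y H K : Type*}
    [AddCommGroup X] [Module ℂ X] [AddCommGroup Y] [Module ℂ Y]
    [AddCommGroup H] [Module ℂ H] [AddCommGroup K] [Module ℂ K]
    (A : X →ₗ[ℂ] H) (B : Y →ₗ[ℂ] H) (D : Y →ₗ[ℂ] K) (T : X × Y →ₗ[ℂ] H × K)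
    (hT : ∀ x y, T (x, y) = (A x + B y, D y)) :
    ∃ k r c : ℕ∞,
      length ℂ (LinearMap.ker T) = length ℂ (LinearMap.ker A) + k ∧
      length ℂ (LinearMap.ker D) = k + r ∧
      length ℂ (H ⧸ LinearMap.range A) = r + c ∧
      length ℂ ((H × K) ⧸ LinearMap.range T) = c + length ℂ (K ⧸ LinearMap.range D) := by
  let δ : LinearMap.ker D →ₗ[ℂ] H ⧸ LinearMap.range A :=
    (LinearMap.range A).mkQ ∘ₗ B ∘ₗ (LinearMap.ker D).subtype
  have hδ (y : LinearMap.ker D) : δ y = 0 ↔ ∃ x, A x = B y := by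
    simp [δ]
  refine ⟨length ℂ (LinearMap.ker δ), length ℂ (LinearMap.range δ),
    length ℂ ((H ⧸ LinearMap.range A) ⧸ LinearMap.range δ), ?_, ?_, ?_, ?_⟩
  · let f : LinearMap.ker A →ₗ[ℂ] LinearMap.ker T :=
      ((LinearMap.inl ℂ X Y) ∘ₗ (LinearMap.ker A).subtype).codRestrict _ fun x => by simp [hT]
    let g₀ : LinearMap.ker T →ₗ[ℂ] LinearMap.ker D :=
      ((LinearMap.snd ℂ X Y) ∘ₗ (LinearMap.ker T).subtype).codRestrict _ fun p => by
        have := p.2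
        rw [LinearMap.mem_ker, ← Prod.mk.eta (p := (p : X × Y)), hT] at this
        exact congrArg Prod.snd this
    let g : LinearMap.ker T →ₗ[ℂ] LinearMap.ker δ := g₀.codRestrict _ fun p => by
      have := p.2
      rw [LinearMap.mem_ker, ← Prod.mk.eta (p := (p : X × Y)), hT] at this
      rw [LinearMap.mem_ker, hδ]
      refine ⟨-(p : X × Y).1, ?_⟩
      rw [map_neg]
      exact neg_eq_of_add_eq_zero_right (congrArg Prod.fst this)
    refine length_eq_add_of_exact f g ?_ ?_ ?_
    · intro x y h
      exact Subtype.ext (congrArg (fun p : LinearMap.ker T => (p : X × Y).1) h)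
    · rintro ⟨y, hy⟩
      obtain ⟨x, hx⟩ := (hδ y).1 hy
      refine ⟨⟨(-x, y), ?_⟩, rfl⟩
      rw [LinearMap.mem_ker, hT, map_neg, hx, neg_add_cancel, y.2]
      rfl
    · rintro ⟨⟨x, y⟩, hp⟩
      constructor
      · intro h
        have hy : y = 0 := congrArg (fun q : LinearMap.ker δ => ((q : LinearMap.ker D) : Y)) h
        subst hy
        have hx : A x = 0 := by
          rw [LinearMap.mem_ker, hT] at hp
          simpa using congrArg Prod.fst hp
        exact ⟨⟨x, hx⟩, rfl⟩
      · rintro ⟨z, hz⟩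
        apply Subtype.ext
        apply Subtype.ext
        exact (congrArg (fun p : LinearMap.ker T => (p : X × Y).2) hz).symm
  · exact length_eq_add_of_exact (LinearMap.ker δ).subtype δ.rangeRestrict
      Subtype.val_injective δ.surjective_rangeRestrict
      (by rw [LinearMap.exact_iff]; simp)
  · exact length_eq_add_of_exact (LinearMap.range δ).subtype (LinearMap.range δ).mkQ
      Subtype.val_injective (Submodule.mkQ_surjective _)
      (by rw [LinearMap.exact_iff]; simp)
  · have hTA : LinearMap.range A ≤
        LinearMap.ker ((LinearMap.range T).mkQ ∘ₗ LinearMap.inl ℂ H K) := by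
      rintro _ ⟨x, rfl⟩
      simp only [LinearMap.mem_ker, LinearMap.comp_apply, Submodule.mkQ_apply,
        Submodule.Quotient.mk_eq_zero]
      exact ⟨(x, 0), by simp [hT]⟩
    have hTδ : LinearMap.range δ ≤ LinearMap.ker ((LinearMap.range A).liftQ _ hTA) := by
      rintro _ ⟨y, rfl⟩
      simp only [δ, LinearMap.mem_ker, LinearMap.comp_apply, Submodule.mkQ_apply,
        Submodule.liftQ_apply, Submodule.Quotient.mk_eq_zero]
      exact ⟨(0, y), by simp [hT]⟩
    have hTD : LinearMap.range T ≤ (LinearMap.range D).comap (LinearMap.snd ℂ H K) := by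
      rintro _ ⟨⟨x, y⟩, rfl⟩
      exact ⟨y, by rw [hT]; rfl⟩
    refine length_eq_add_of_exact ((LinearMap.range δ).liftQ _ hTδ)
      ((LinearMap.range T).mapQ _ (LinearMap.snd ℂ H K) hTD) ?_ ?_ ?_
    · rw [← LinearMap.ker_eq_bot, eq_bot_iff]
      intro z hz
      obtain ⟨z, rfl⟩ := Submodule.mkQ_surjective _ z
      obtain ⟨h, rfl⟩ := Submodule.mkQ_surjective _ z
      simp only [LinearMap.mem_ker, Submodule.mkQ_apply, Submodule.liftQ_apply,
        LinearMap.comp_apply, Submodule.Quotient.mk_eq_zero] at hz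
      obtain ⟨⟨x, y⟩, hxy⟩ := hz
      rw [hT] at hxy
      have h1 : A x + B y = h := congrArg Prod.fst hxy
      have h2 : D y = 0 := congrArg Prod.snd hxy
      rw [Submodule.mem_bot, Submodule.mkQ_apply, Submodule.Quotient.mk_eq_zero]
      refine ⟨⟨y, h2⟩, ?_⟩
      simp only [δ, LinearMap.comp_apply, Submodule.mkQ_apply, Submodule.subtype_apply]
      rw [Submodule.Quotient.eq]
      exact ⟨-x, by rw [map_neg, ← h1]; abel⟩
    · intro z
      obtain ⟨z, rfl⟩ := Submodule.mkQ_surjective _ z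
      exact ⟨(LinearMap.range T).mkQ (0, z), rfl⟩
    · intro z
      obtain ⟨⟨h, k⟩, rfl⟩ := Submodule.mkQ_surjective _ z
      simp only [Submodule.mkQ_apply, Submodule.mapQ_apply, Submodule.Quotient.mk_eq_zero]
      constructor
      · rintro ⟨y, hy⟩
        -- If `k = D y`, subtracting `T (0, y)` moves `(h, k)` to `(h - B y, 0)` within its class.
        refine ⟨(LinearMap.range δ).mkQ ((LinearMap.range A).mkQ (h - B y)), ?_⟩
        simp only [Submodule.mkQ_apply, Submodule.liftQ_apply, LinearMap.comp_apply]
        rw [Submodule.Quotient.eq]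
        refine ⟨(0, -y), ?_⟩
        rw [hT, map_neg, map_neg, hy]
        simp
      · rintro ⟨w, hw⟩
        obtain ⟨w, rfl⟩ := Submodule.mkQ_surjective _ w
        obtain ⟨w, rfl⟩ := Submodule.mkQ_surjective _ w
        simp only [Submodule.mkQ_apply, Submodule.liftQ_apply, LinearMap.comp_apply] at hw
        rw [Submodule.Quotient.eq] at hw
        obtain ⟨⟨x, y⟩, hxy⟩ := hw
        rw [hT] at hxy
        refine ⟨-y, ?_⟩
        have : D y = 0 - k := congrArg Prod.snd hxy
        rw [map_neg, this]
        simp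

/-! ### Closed images and Hilbert space embeddings. -/

/-- By the open mapping theorem `S` is a quotient map onto its range, and the preimage of `S(M)` is
`M + ker S`, closed because `ker S` is finite-dimensional. -/
theorem isClosed_map_of_finiteDimensional_ker {G F : Type*}
    [NormedAddCommGroup G] [NormedSpace ℂ G] [CompleteSpace G]
    [NormedAddCommGroup F] [NormedSpace ℂ F] [CompleteSpace F]
    (S : G →L[ℂ] F) (hS : IsClosed (LinearMap.range S.toLinearMap : Set F))
    [FiniteDimensional ℂ (LinearMap.ker S.toLinearMap)]
    {M : Submodule ℂ G} (hM : IsClosed (M : Set G)) :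
    IsClosed (M.map S.toLinearMap : Set F) := by
  have : CompleteSpace (LinearMap.range S.toLinearMap) := hS.completeSpace_coe
  let S' : G →L[ℂ] LinearMap.range S.toLinearMap :=
    S.codRestrict _ fun x => ⟨x, rfl⟩
  have hsurj : Function.Surjective S' := by
    rintro ⟨_, x, rfl⟩
    exact ⟨x, rfl⟩
  have hquot := S'.isQuotientMap hsurj
  have hker : S' ⁻¹' (S' '' M) = ((M ⊔ LinearMap.ker S.toLinearMap : Submodule ℂ G) : Set G) := by
    ext x
    simp only [Set.mem_preimage, Set.mem_image, SetLike.mem_coe, Submodule.mem_sup]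
    constructor
    · rintro ⟨m, hm, h⟩
      refine ⟨m, hm, x - m, ?_, by abel⟩
      have : S m = S x := congrArg Subtype.val h
      simp [this]
    · rintro ⟨m, hm, z, hz, rfl⟩
      have hz : S z = 0 := hz
      exact ⟨m, hm, Subtype.ext (by simp [S', hz])⟩
  have hcl : IsClosed (S' '' M) := by
    rw [← hquot.isClosed_preimage, hker]
    exact Submodule.isClosed_sup_finiteDimensional _ _ hM
  have himg : (M.map S.toLinearMap : Set F) = Subtype.val '' (S' '' M) := by
    rw [← Set.image_comp]
    rfl
  rw [himg]
  exact hS.isClosedEmbedding_subtypeVal.isClosedMap _ hcl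

theorem exists_hilbertBasis_nat {E : Type*} [NormedAddCommGroup E] [InnerProductSpace ℂ E]
    [CompleteSpace E] [TopologicalSpace.SeparableSpace E] (hE : ¬ FiniteDimensional ℂ E) :
    Nonempty (HilbertBasis ℕ ℂ E) := by
  obtain ⟨w, b, hb⟩ := exists_hilbertBasis ℂ E
  -- Distinct orthonormal vectors are at distance `√2`, so balls of radius `1/2` around them are
  -- disjoint open sets in a separable space.
  have hcount : w.Countable := by
    refine Set.PairwiseDisjoint.countable_of_isOpen (s := fun x => Metric.ball x (1 / 2)) ?_
      (fun _ _ => Metric.isOpen_ball) (fun x _ => ⟨x, by simp⟩)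
    intro x hx y hy hxy
    apply Metric.ball_disjoint_ball
    have hne : (⟨x, hx⟩ : w) ≠ ⟨y, hy⟩ := fun h => hxy (congrArg Subtype.val h)
    have horth := b.orthonormal.2 hne
    have hx1 := b.orthonormal.1 ⟨x, hx⟩
    have hy1 := b.orthonormal.1 ⟨y, hy⟩
    simp only [hb] at horth hx1 hy1
    have h := norm_sub_sq (𝕜 := ℂ) x y
    rw [hx1, hy1, horth, map_zero] at h
    rw [dist_eq_norm]
    nlinarith [norm_nonneg (x - y)]
  have hinf : Infinite w := by
    by_contra hfin
    have := not_infinite_iff_finite.1 hfin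
    have := Fintype.ofFinite w
    exact hE b.toOrthonormalBasis.toBasis.finiteDimensional_of_finite
  have := hcount.to_subtype
  obtain ⟨e⟩ := nonempty_equiv_of_countable (α := ℕ) (β := w)
  refine ⟨HilbertBasis.mk (b.orthonormal.comp e e.injective) ?_⟩
  rw [e.surjective.range_comp, b.dense_span]

theorem nonempty_linearIsometryEquiv {E F : Type*}
    [NormedAddCommGroup E] [InnerProductSpace ℂ E] [CompleteSpace E]
    [TopologicalSpace.SeparableSpace E]
    [NormedAddCommGroup F] [InnerProductSpace ℂ F] [CompleteSpace F]
    [TopologicalSpace.SeparableSpace F]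
    (hE : ¬ FiniteDimensional ℂ E) (hF : ¬ FiniteDimensional ℂ F) : Nonempty (E ≃ₗᵢ[ℂ] F) := by
  obtain ⟨b⟩ := exists_hilbertBasis_nat hE
  obtain ⟨c⟩ := exists_hilbertBasis_nat hF
  exact ⟨b.repr.trans c.repr.symm⟩

/-- A closed subspace `M` of infinite codimension has room for two independent copies of `K`: one
is the range of `J`, read off by `Q`, and the other is read off by `R`. -/
theorem exists_embedding_of_infinite_codim {H K : Type*}
    [NormedAddCommGroup H] [InnerProductSpace ℂ H] [CompleteSpace H]
    [TopologicalSpace.SeparableSpace H]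
    [NormedAddCommGroup K] [InnerProductSpace ℂ K] [CompleteSpace K]
    [TopologicalSpace.SeparableSpace K]
    (hK : ¬ FiniteDimensional ℂ K) {M : Submodule ℂ H} (hM : IsClosed (M : Set H))
    (hMc : ¬ FiniteDimensional ℂ (H ⧸ M)) :
    ∃ (J : K →L[ℂ] H) (Q R : H →L[ℂ] K), (∀ y, Q (J y) = y) ∧ (∀ x ∈ M, Q x = 0) ∧
      (∀ y, R (J y) = 0) ∧ (∀ x ∈ M, R x = 0) ∧ Function.Surjective R := by
  have : CompleteSpace M := hM.completeSpace_coe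
  have hMo : ¬ FiniteDimensional ℂ Mᗮ := fun h => hMc
    ((Submodule.quotientEquivOfIsCompl M Mᗮ M.isCompl_orthogonal).symm.finiteDimensional)
  have hKK : ¬ FiniteDimensional ℂ (WithLp 2 (K × K)) := fun h => hK
    (FiniteDimensional.of_surjective (WithLp.fstL 2 ℂ K K).toLinearMap
      fun y => ⟨WithLp.toLp 2 (y, 0), rfl⟩)
  have : TopologicalSpace.SeparableSpace (WithLp 2 (K × K)) :=
    (WithLp.prodContinuousLinearEquiv 2 ℂ K K).symm.surjective.denseRange.separableSpace
      (WithLp.prodContinuousLinearEquiv 2 ℂ K K).symm.continuous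
  -- Identifying the complement with `K × K` gives one factor to embed into and a spare one that
  -- keeps the codimension infinite.
  obtain ⟨U⟩ := nonempty_linearIsometryEquiv hKK hMo
  let e : Mᗮ ≃L[ℂ] K × K :=
    U.symm.toContinuousLinearEquiv.trans (WithLp.prodContinuousLinearEquiv 2 ℂ K K)
  let P := Mᗮ.orthogonalProjectionOnto
  have hP (x : H) (hx : x ∈ M) : P x = 0 :=
    Submodule.orthogonalProjectionOnto_eq_zero_iff.2 (M.le_orthogonal_orthogonal hx)
  have hP' (x : Mᗮ) : P x = x := Submodule.orthogonalProjectionOnto_mem_subspace_eq_self x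
  refine ⟨Mᗮ.subtypeL ∘L e.symm.toContinuousLinearMap ∘L ContinuousLinearMap.inl ℂ K K,
    ContinuousLinearMap.fst ℂ K K ∘L e.toContinuousLinearMap ∘L P,
    ContinuousLinearMap.snd ℂ K K ∘L e.toContinuousLinearMap ∘L P, ?_, ?_, ?_, ?_, ?_⟩
  · intro y
    simp [hP']
  · intro x hx
    simp [hP x hx]
  · intro y
    simp [hP']
  · intro x hx
    simp [hP x hx]
  · intro y
    exact ⟨e.symm (0, y), by simp [hP']⟩

/-! ### Partially defined operators through their graphs. -/

section PartialOperators

variable {E F : Type*} [NormedAddCommGroup E] [NormedSpace ℂ E]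
  [NormedAddCommGroup F] [NormedSpace ℂ F]

/-- Length takes values in `ℕ∞` and is additive on short exact sequences without finiteness
assumptions. -/
theorem opAlpha_eq_length (T : E →ₗ.[ℂ] F) :
    opAlpha T = Module.length ℂ (LinearMap.ker T.toFun) := by
  rw [opAlpha, ← Module.length_eq_rank]
  exact ((LinearMap.ker T.toFun).equivMapOfInjective T.domain.subtype
    Subtype.val_injective).symm.length_eq

theorem opBeta_eq_length (T : E →ₗ.[ℂ] F) :
    opBeta T = Module.length ℂ (F ⧸ LinearMap.range T.toFun) := by
  rw [Module.length_eq_rank]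
  rfl

theorem opAlpha_lt_top_iff {T : E →ₗ.[ℂ] F} :
    opAlpha T < ⊤ ↔ FiniteDimensional ℂ (opKer T) := by
  rw [opAlpha, Cardinal.toENat_lt_top]
  exact Module.rank_lt_aleph0_iff

theorem opBeta_eq_top_iff {T : E →ₗ.[ℂ] F} :
    opBeta T = ⊤ ↔ ¬ FiniteDimensional ℂ (F ⧸ opRange T) := by
  rw [← not_lt_top_iff, opBeta, Cardinal.toENat_lt_top]
  exact not_congr Module.rank_lt_aleph0_iff

theorem mem_opRange_iff {T : E →ₗ.[ℂ] F} {z : F} :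
    z ∈ opRange T ↔ ∃ x, (x, z) ∈ T.graph := by
  rw [← LinearPMap.mem_range_iff]
  rfl

theorem mem_opKer_iff {T : E →ₗ.[ℂ] F} {x : E} :
    x ∈ opKer T ↔ (x, 0) ∈ T.graph := by
  simp [opKer, LinearPMap.mem_graph_iff]

theorem opInd_nonpos_iff {T : E →ₗ.[ℂ] F} :
    opInd T ≤ 0 ↔ opAlpha T ≤ opBeta T := by
  rw [opInd, EReal.sub_nonpos, EReal.coe_ennreal_le_coe_ennreal_iff, ENat.toENNReal_le]

/-- A semi-Fredholm operator maps those subspaces of its domain that are traces of closed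
subspaces onto closed subspaces. -/
theorem IsUpperSemiFredholm.isClosed_map_graph [CompleteSpace E] [CompleteSpace F]
    {T : E →ₗ.[ℂ] F} (hT : IsUpperSemiFredholm T) {M : Submodule ℂ E}
    (hM : IsClosed (M : Set E)) :
    IsClosed {z : F | ∃ x ∈ M, (x, z) ∈ T.graph} := by
  have : CompleteSpace T.graph := IsClosed.completeSpace_coe (hs := hT.closed)
  -- On its graph, a Banach space, the closed operator becomes a bounded projection with the same
  -- range and an isomorphic kernel.
  let S : T.graph →L[ℂ] F := ContinuousLinearMap.snd ℂ E F ∘L T.graph.subtypeL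
  let p : T.graph →L[ℂ] E := ContinuousLinearMap.fst ℂ E F ∘L T.graph.subtypeL
  have hrange : LinearMap.range S.toLinearMap = opRange T := by
    ext z
    rw [mem_opRange_iff]
    constructor
    · rintro ⟨⟨⟨x, z⟩, h⟩, rfl⟩
      exact ⟨x, h⟩
    · rintro ⟨x, h⟩
      exact ⟨⟨⟨x, z⟩, h⟩, rfl⟩
  have hker : FiniteDimensional ℂ (LinearMap.ker S.toLinearMap) := by
    have := opAlpha_lt_top_iff.1 hT.alpha_lt_top
    have hmem (g : LinearMap.ker S.toLinearMap) :
        (p.toLinearMap ∘ₗ (LinearMap.ker S.toLinearMap).subtype) g ∈ opKer T := by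
      obtain ⟨⟨⟨x, z⟩, h⟩, hz⟩ := g
      have hz : z = 0 := hz
      subst hz
      exact mem_opKer_iff.2 h
    refine FiniteDimensional.of_injective (LinearMap.codRestrict (opKer T) _ hmem) ?_
    rintro ⟨⟨⟨x, z⟩, h⟩, hz⟩ ⟨⟨⟨x', z'⟩, h'⟩, hz'⟩ hxx
    have hz : z = 0 := hz
    have hz' : z' = 0 := hz'
    have hx : x = x' := congrArg Subtype.val hxx
    subst hz hz'
    subst hx
    rfl
  have := isClosed_map_of_finiteDimensional_ker S (by rw [hrange]; exact hT.closed_range)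
    (M := M.comap p.toLinearMap) (hM.preimage p.continuous)
  convert this using 1
  ext z
  constructor
  · rintro ⟨x, hx, h⟩
    exact ⟨⟨⟨x, z⟩, h⟩, hx, rfl⟩
  · rintro ⟨⟨⟨x, z⟩, h⟩, hx, rfl⟩
    exact ⟨x, hx, h⟩

end PartialOperators

/-! ### The graph and the dimensions of the operator matrix. -/

section UpperTriangular

variable {H K : Type*}

section Normed

variable [NormedAddCommGroup H] [NormedSpace ℂ H] [NormedAddCommGroup K] [NormedSpace ℂ K]
  {A : H →ₗ.[ℂ] H} {B : K →ₗ.[ℂ] H} {D : K →ₗ.[ℂ] K}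

theorem mem_graph_upperTriangular_iff (hB : D.domain ≤ B.domain) {p q : WithLp 2 (H × K)} :
    (p, q) ∈ (upperTriangular A B D hB).graph ↔
      ∃ w, (p.snd, w) ∈ B.graph ∧ (p.fst, q.fst - w) ∈ A.graph ∧ (p.snd, q.snd) ∈ D.graph := by
  simp only [LinearPMap.mem_graph_iff]
  constructor
  · rintro ⟨⟨p, hp⟩, rfl, rfl⟩
    exact ⟨_, ⟨⟨p.snd, hB hp.2⟩, rfl, rfl⟩,
      ⟨⟨p.fst, hp.1⟩, rfl, (add_sub_cancel_right _ _).symm⟩, ⟨⟨p.snd, hp.2⟩, rfl, rfl⟩⟩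
  · rintro ⟨w, ⟨⟨y, hy⟩, h1, rfl⟩, ⟨⟨x, hx⟩, h2, h3⟩, ⟨⟨y', hy'⟩, h4, h5⟩⟩
    have h1 : y = p.snd := h1
    have h2 : x = p.fst := h2
    have h4 : y' = p.snd := h4
    subst h1 h2 h4
    refine ⟨⟨p, hx, hy'⟩, rfl, ?_⟩
    have h3 := eq_sub_iff_add_eq.1 h3
    change WithLp.toLp 2 (A ⟨p.fst, hx⟩ + B ⟨p.snd, hy⟩, D ⟨p.snd, hy'⟩) = q
    rw [h3, h5]
    rfl

theorem mem_graph_upperTriangular_toPMap_iff {L : K →L[ℂ] H}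
    (hB : D.domain ≤ (L.toLinearMap.toPMap ⊤).domain) {p q : WithLp 2 (H × K)} :
    (p, q) ∈ (upperTriangular A (L.toLinearMap.toPMap ⊤) D hB).graph ↔
      (p.fst, q.fst - L p.snd) ∈ A.graph ∧ (p.snd, q.snd) ∈ D.graph := by
  have hL (y : K) (w : H) : (y, w) ∈ (L.toLinearMap.toPMap ⊤).graph ↔ L y = w := by
    rw [LinearPMap.mem_graph_iff]
    constructor
    · rintro ⟨y, rfl, rfl⟩
      rfl
    · rintro rfl
      exact ⟨⟨y, trivial⟩, rfl, rfl⟩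
  simp only [mem_graph_upperTriangular_iff, hL, exists_eq_left']

theorem toPMap_mem_closableOver (D : K →ₗ.[ℂ] K) (L : K →L[ℂ] H) :
    L.toLinearMap.toPMap ⊤ ∈ closableOver (H := H) D := by
  refine ⟨LinearPMap.IsClosed.isClosable ?_, le_top⟩
  have : ((L.toLinearMap.toPMap ⊤).graph : Set (K × H)) = {z | L z.1 = z.2} := by
    ext ⟨y, w⟩
    simp [LinearPMap.mem_graph_iff]
  rw [LinearPMap.IsClosed, this]
  exact isClosed_eq (by fun_prop) (by fun_prop)

theorem isClosed_upperTriangular_toPMap (hA : A.IsClosed) (hD : D.IsClosed) (L : K →L[ℂ] H)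
    (hB : D.domain ≤ (L.toLinearMap.toPMap ⊤).domain) :
    (upperTriangular A (L.toLinearMap.toPMap ⊤) D hB).IsClosed := by
  have hg : ((upperTriangular A (L.toLinearMap.toPMap ⊤) D hB).graph :
        Set (WithLp 2 (H × K) × WithLp 2 (H × K))) =
      (fun z => (z.1.fst, z.2.fst - L z.1.snd)) ⁻¹' (A.graph : Set (H × H)) ∩
        (fun z => (z.1.snd, z.2.snd)) ⁻¹' (D.graph : Set (K × K)) := by
    ext ⟨p, q⟩
    exact mem_graph_upperTriangular_toPMap_iff hB
  rw [LinearPMap.IsClosed, hg]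
  exact (IsClosed.preimage (by fun_prop) hA).inter (IsClosed.preimage (by fun_prop) hD)

theorem dense_domain_upperTriangular (hAd : Dense (A.domain : Set H))
    (hDd : Dense (D.domain : Set K)) (hB : D.domain ≤ B.domain) :
    Dense ((upperTriangular A B D hB).domain : Set (WithLp 2 (H × K))) :=
  (hAd.prod hDd).preimage (WithLp.homeomorphProd 2 H K).isOpenMap

theorem exists_opAlpha_opBeta_upperTriangular (hB : D.domain ≤ B.domain) :
    ∃ k r c : ℕ∞,
      opAlpha (upperTriangular A B D hB) = opAlpha A + k ∧ opAlpha D = k + r ∧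
      opBeta A = r + c ∧ opBeta (upperTriangular A B D hB) = c + opBeta D := by
  let e : (upperTriangular A B D hB).domain ≃ₗ[ℂ] A.domain × D.domain :=
    { toFun := fun p => (⟨p.1.fst, p.2.1⟩, ⟨p.1.snd, p.2.2⟩)
      invFun := fun z => ⟨WithLp.toLp 2 (z.1, z.2), z.1.2, z.2.2⟩
      left_inv := fun _ => rfl
      right_inv := fun _ => rfl
      map_add' := fun _ _ => rfl
      map_smul' := fun _ _ => rfl }
  let l : WithLp 2 (H × K) ≃ₗ[ℂ] H × K := WithLp.linearEquiv 2 ℂ (H × K)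
  let T : A.domain × D.domain →ₗ[ℂ] H × K :=
    l.toLinearMap ∘ₗ (upperTriangular A B D hB).toFun ∘ₗ e.symm.toLinearMap
  obtain ⟨k, r, c, h1, h2, h3, h4⟩ := exists_length_blockTriangular A.toFun
    (B.toFun ∘ₗ Submodule.inclusion hB) D.toFun T fun _ _ => rfl
  have hker : (LinearMap.ker (upperTriangular A B D hB).toFun).map e.toLinearMap =
      LinearMap.ker T := by
    rw [LinearEquiv.ker_comp, LinearMap.ker_comp, ← Submodule.map_equiv_eq_comap_symm]
  have hrange : (LinearMap.range (upperTriangular A B D hB).toFun).map l.toLinearMap =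
      LinearMap.range T := by
    rw [LinearMap.range_comp, LinearMap.range_comp_of_range_eq_top _ e.symm.range]
  have hα : Module.length ℂ (LinearMap.ker (upperTriangular A B D hB).toFun) =
      Module.length ℂ (LinearMap.ker T) := by
    rw [← hker]
    exact (e.submoduleMap _).length_eq
  have hβ : Module.length ℂ (WithLp 2 (H × K) ⧸ LinearMap.range (upperTriangular A B D hB).toFun) =
      Module.length ℂ ((H × K) ⧸ LinearMap.range T) :=
    (Submodule.Quotient.equiv _ _ l hrange).length_eq
  refine ⟨k, r, c, ?_, ?_, ?_, ?_⟩
  · rw [opAlpha_eq_length, opAlpha_eq_length, hα, h1]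
  · rw [opAlpha_eq_length, h2]
  · rw [opBeta_eq_length, h3]
  · rw [opBeta_eq_length, opBeta_eq_length, hβ, h4]

/-! ### Necessity. -/

theorem isUpperSemiFredholm_of_upperTriangular [CompleteSpace H] [CompleteSpace K]
    (hA : A.IsClosed) (hAd : Dense (A.domain : Set H)) (hB : D.domain ≤ B.domain)
    (hT : IsUpperSemiFredholm (upperTriangular A B D hB)) : IsUpperSemiFredholm A := by
  obtain ⟨k, -, -, hk, -⟩ := exists_opAlpha_opBeta_upperTriangular (A := A) hB
  refine ⟨hA, hAd, ?_, ?_⟩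
  · have := hT.alpha_lt_top
    rw [hk] at this
    exact (ENat.add_lt_top.1 this).1
  · have hcl := hT.isClosed_map_graph (M := LinearMap.ker (WithLp.sndL 2 ℂ H K).toLinearMap)
      (ContinuousLinearMap.isClosed_ker (WithLp.sndL 2 ℂ H K))
    have hpre := hcl.preimage (f := fun x : H => WithLp.toLp 2 (x, (0 : K))) (by fun_prop)
    convert hpre using 1
    ext z
    simp only [SetLike.mem_coe, mem_opRange_iff, Set.mem_preimage, Set.mem_ofPred_eq,
      mem_graph_upperTriangular_iff]
    constructor
    · rintro ⟨x, hx⟩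
      exact ⟨WithLp.toLp 2 (x, 0), rfl, 0, B.graph.zero_mem, by simpa using hx, D.graph.zero_mem⟩
    · rintro ⟨p, hp, w, hw, hx, -⟩
      have hp : p.snd = 0 := hp
      rw [hp] at hw
      have hw : w = 0 := B.graph_fst_eq_zero_snd hw rfl
      subst hw
      exact ⟨p.fst, by simpa using hx⟩

/-- If `N` is a finite-dimensional complement of `R(A)`, then `R(T) + (N ⊕ 0) = H ⊕ R(D)` is closed,
and `R(D)` is its slice over `0`. -/
theorem isClosed_opRange_of_upperTriangular (hB : D.domain ≤ B.domain)
    (hT : IsClosed (opRange (upperTriangular A B D hB) : Set (WithLp 2 (H × K))))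
    (hβ : opBeta A ≠ ⊤) : IsClosed (opRange D : Set K) := by
  have hfin : FiniteDimensional ℂ (H ⧸ opRange A) := by
    by_contra h
    exact hβ (opBeta_eq_top_iff.2 h)
  obtain ⟨N, hN⟩ := (opRange A).exists_isCompl
  have : FiniteDimensional ℂ N :=
    (Submodule.quotientEquivOfIsCompl _ _ hN).finiteDimensional
  let i : H →ₗ[ℂ] WithLp 2 (H × K) :=
    (WithLp.linearEquiv 2 ℂ (H × K)).symm.toLinearMap ∘ₗ LinearMap.inl ℂ H K
  have hcl := Submodule.isClosed_sup_finiteDimensional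
    (opRange (upperTriangular A B D hB)) (N.map i) hT
  have hpre := hcl.preimage (f := fun y : K => WithLp.toLp 2 ((0 : H), y)) (by fun_prop)
  have hAT (x : H) (hx : x ∈ opRange A) : i x ∈ opRange (upperTriangular A B D hB) := by
    obtain ⟨u, hu⟩ := mem_opRange_iff.1 hx
    rw [mem_opRange_iff]
    refine ⟨WithLp.toLp 2 (u, 0), (mem_graph_upperTriangular_iff hB).2
      ⟨0, B.graph.zero_mem, ?_, D.graph.zero_mem⟩⟩
    rw [sub_zero]
    exact hu
  convert hpre using 1
  ext z
  simp only [Set.mem_preimage, SetLike.mem_coe]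
  constructor
  · intro hz
    obtain ⟨⟨y, hy⟩, rfl⟩ := hz
    have hmem : B ⟨y, hB hy⟩ ∈ opRange A ⊔ N := by
      rw [hN.sup_eq_top]
      trivial
    obtain ⟨a, ha, n, hn, han⟩ := Submodule.mem_sup.1 hmem
    have hy' : WithLp.toLp 2 (B ⟨y, hB hy⟩, D ⟨y, hy⟩) ∈
        opRange (upperTriangular A B D hB) :=
      mem_opRange_iff.2 ⟨WithLp.toLp 2 (0, y), (mem_graph_upperTriangular_iff hB).2
        ⟨_, B.mem_graph ⟨y, hB hy⟩, by simp, D.mem_graph ⟨y, hy⟩⟩⟩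
    -- With `B y = a + n`, this writes `(0, D y)` as `(B y, D y) - (a, 0) + (-n, 0)`.
    refine Submodule.mem_sup.2 ⟨_, Submodule.sub_mem _ hy' (hAT a ha), i (-n),
      ⟨-n, N.neg_mem hn, rfl⟩, ?_⟩
    rw [← han]
    apply (WithLp.linearEquiv 2 ℂ (H × K)).injective
    change (a + n - a + -n, D ⟨y, hy⟩ - 0 + 0) = (0, D ⟨y, hy⟩)
    simp
  · intro hz
    obtain ⟨t, ht, _, ⟨n, -, rfl⟩, h⟩ := Submodule.mem_sup.1 hz
    obtain ⟨p, hp⟩ := mem_opRange_iff.1 ht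
    obtain ⟨-, -, -, hD⟩ := (mem_graph_upperTriangular_iff hB).1 hp
    have h : t.snd + 0 = z := congrArg WithLp.snd h
    rw [add_zero] at h
    exact mem_opRange_iff.2 ⟨p.snd, h ▸ hD⟩

theorem opAlpha_add_le_of_upperTriangular (hB : D.domain ≤ B.domain)
    (hα : opAlpha (upperTriangular A B D hB) < ⊤)
    (hle : opAlpha (upperTriangular A B D hB) ≤ opBeta (upperTriangular A B D hB))
    (hβ : opBeta A ≠ ⊤) : opAlpha D < ⊤ ∧ opAlpha A + opAlpha D ≤ opBeta A + opBeta D := by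
  obtain ⟨k, r, c, h1, h2, h3, h4⟩ := exists_opAlpha_opBeta_upperTriangular (A := A) hB
  rw [h1] at hα hle
  rw [h4] at hle
  rw [h3] at hβ ⊢
  rw [h2]
  refine ⟨ENat.add_lt_top.2 ⟨(ENat.add_lt_top.1 hα).2, (ENat.add_lt_top.1 hβ.lt_top).1⟩, ?_⟩
  calc opAlpha A + (k + r) = (opAlpha A + k) + r := (add_assoc _ _ _).symm
    _ ≤ (c + opBeta D) + r := by gcongr
    _ = r + c + opBeta D := by ring

/-! ### Sufficiency. -/

theorem isUpperSemiWeyl_upperTriangular_zero (hA : IsUpperSemiFredholm A) (hD : D.IsClosed)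
    (hDd : Dense (D.domain : Set K)) (hDr : IsClosed (opRange D : Set K)) (hα : opAlpha D < ⊤)
    (hle : opAlpha A + opAlpha D ≤ opBeta A + opBeta D)
    (hB : D.domain ≤ ((0 : K →L[ℂ] H).toLinearMap.toPMap ⊤).domain) :
    IsUpperSemiWeyl (upperTriangular A ((0 : K →L[ℂ] H).toLinearMap.toPMap ⊤) D hB) := by
  obtain ⟨k, r, c, h1, h2, h3, h4⟩ := exists_opAlpha_opBeta_upperTriangular (A := A) hB
  rw [h2] at hα hle
  obtain ⟨hk, hr⟩ := ENat.add_lt_top.1 hα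
  have hαT := ENat.add_lt_top.2 ⟨hA.alpha_lt_top, hk⟩
  rw [← h1] at hαT
  refine ⟨⟨isClosed_upperTriangular_toPMap hA.closed hD 0 hB,
    dense_domain_upperTriangular hA.dense hDd hB, hαT, ?_⟩, ?_⟩
  · have hrange : (opRange (upperTriangular A ((0 : K →L[ℂ] H).toLinearMap.toPMap ⊤) D hB) :
        Set (WithLp 2 (H × K))) =
        (fun q => q.fst) ⁻¹' (opRange A : Set H) ∩ (fun q => q.snd) ⁻¹' (opRange D : Set K) := by
      ext q
      simp only [SetLike.mem_coe, Set.mem_inter_iff, Set.mem_preimage, mem_opRange_iff,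
        mem_graph_upperTriangular_toPMap_iff, zero_apply, sub_zero]
      constructor
      · rintro ⟨p, hp1, hp2⟩
        exact ⟨⟨_, hp1⟩, ⟨_, hp2⟩⟩
      · rintro ⟨⟨x, hx⟩, ⟨y, hy⟩⟩
        exact ⟨WithLp.toLp 2 (x, y), hx, hy⟩
    rw [hrange]
    exact (hA.closed_range.preimage (by fun_prop)).inter (hDr.preimage (by fun_prop))
  · rw [opInd_nonpos_iff, h1, h4]
    rw [h3] at hle
    -- Cancelling `r` is legitimate because `r ≤ α(D) < ∞`.
    refine (ENat.add_le_add_iff_right hr.ne).1 ?_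
    calc opAlpha A + k + r = opAlpha A + (k + r) := add_assoc _ _ _
      _ ≤ r + c + opBeta D := hle
      _ = c + opBeta D + r := by ring

end Normed

theorem exists_isUpperSemiWeyl_upperTriangular_of_opBeta_eq_top
    [NormedAddCommGroup H] [InnerProductSpace ℂ H] [CompleteSpace H]
    [TopologicalSpace.SeparableSpace H]
    [NormedAddCommGroup K] [InnerProductSpace ℂ K] [CompleteSpace K]
    [TopologicalSpace.SeparableSpace K]
    (hK : ¬ FiniteDimensional ℂ K) {A : H →ₗ.[ℂ] H} {D : K →ₗ.[ℂ] K}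
    (hA : IsUpperSemiFredholm A) (hD : D.IsClosed) (hDd : Dense (D.domain : Set K))
    (hβ : opBeta A = ⊤) :
    ∃ (B : K →ₗ.[ℂ] H) (hB : B ∈ closableOver (H := H) D),
      IsUpperSemiWeyl (upperTriangular A B D hB.2) := by
  obtain ⟨J, Q, R, hQJ, hQA, hRJ, hRA, hR⟩ :=
    exists_embedding_of_infinite_codim hK hA.closed_range (opBeta_eq_top_iff.1 hβ)
  refine ⟨J.toLinearMap.toPMap ⊤, toPMap_mem_closableOver D J, ?_⟩
  set hB := (toPMap_mem_closableOver D J).2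
  set T := upperTriangular A (J.toLinearMap.toPMap ⊤) D hB
  have hgraph {p q : WithLp 2 (H × K)} : (p, q) ∈ T.graph ↔
      (p.fst, q.fst - J p.snd) ∈ A.graph ∧ (p.snd, q.snd) ∈ D.graph :=
    mem_graph_upperTriangular_toPMap_iff hB
  -- The key point: `Q` kills `R(A)` and inverts `J`, so the value determines the second component
  -- of the argument, boundedly.
  have hQ {p q : WithLp 2 (H × K)} (h : (p, q) ∈ T.graph) : p.snd = Q q.fst := by
    have := hQA _ (mem_opRange_iff.2 ⟨_, (hgraph.1 h).1⟩)
    rw [map_sub, hQJ, sub_eq_zero] at this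
    exact this.symm
  have hα : opAlpha T < ⊤ := by
    have := opAlpha_lt_top_iff.1 hA.alpha_lt_top
    rw [opAlpha_lt_top_iff]
    have hmem (g : opKer T) :
        ((WithLp.fstL 2 ℂ H K).toLinearMap ∘ₗ (opKer T).subtype) g ∈ opKer A := by
      have h := mem_opKer_iff.1 g.2
      have h0 : g.1.snd = 0 := by simpa using hQ h
      have h1 := (hgraph.1 h).1
      rw [h0] at h1
      exact mem_opKer_iff.2 (by simpa using h1)
    refine FiniteDimensional.of_injective (LinearMap.codRestrict (opKer A) _ hmem) ?_
    intro g g' hgg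
    have h1 : g.1.fst = g'.1.fst := congrArg Subtype.val hgg
    have h0 : g.1.snd = 0 := by simpa using hQ (mem_opKer_iff.1 g.2)
    have h0' : g'.1.snd = 0 := by simpa using hQ (mem_opKer_iff.1 g'.2)
    exact Subtype.ext (WithLp.ofLp_injective 2 (Prod.ext h1 (h0.trans h0'.symm)))
  -- `R` applied to the first component kills `R(T)` and maps onto the infinite-dimensional `K`.
  have hβT : opBeta T = ⊤ := by
    rw [opBeta_eq_top_iff]
    intro hfin
    have hle : opRange T ≤ LinearMap.ker (R ∘L WithLp.fstL 2 ℂ H K).toLinearMap := by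
      intro q hq
      obtain ⟨p, hp⟩ := mem_opRange_iff.1 hq
      have := hRA _ (mem_opRange_iff.2 ⟨_, (hgraph.1 hp).1⟩)
      rw [map_sub, hRJ, sub_zero] at this
      exact this
    refine hK (FiniteDimensional.of_surjective ((opRange T).liftQ _ hle) ?_)
    intro y
    obtain ⟨x, hx⟩ := hR y
    exact ⟨(opRange T).mkQ (WithLp.toLp 2 (x, 0)), hx⟩
  refine ⟨⟨isClosed_upperTriangular_toPMap hA.closed hD J hB,
    dense_domain_upperTriangular hA.dense hDd hB, hα, ?_⟩, ?_⟩
  -- Substituting `p.snd = Q q.fst` turns the condition on `D` into membership in its closed graph,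
  -- so `R(D)` need not be closed.
  · have hrange : (opRange T : Set (WithLp 2 (H × K))) =
        (fun q => q.fst - J (Q q.fst)) ⁻¹' (opRange A : Set H) ∩
          (fun q => (Q q.fst, q.snd)) ⁻¹' (D.graph : Set (K × K)) := by
      ext q
      simp only [SetLike.mem_coe, Set.mem_inter_iff, Set.mem_preimage, mem_opRange_iff]
      constructor
      · rintro ⟨p, hp⟩
        rw [← hQ hp]
        exact ⟨⟨_, (hgraph.1 hp).1⟩, (hgraph.1 hp).2⟩
      · rintro ⟨⟨x, hx⟩, hy⟩
        exact ⟨WithLp.toLp 2 (x, Q q.fst), hgraph.2 ⟨hx, hy⟩⟩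
    rw [hrange]
    exact (hA.closed_range.preimage (by fun_prop)).inter (IsClosed.preimage (by fun_prop) hD)
  · rw [opInd_nonpos_iff, hβT]
    exact le_top

end UpperTriangular

theorem lemma2p2 {H K : Type*}
    [NormedAddCommGroup H] [InnerProductSpace ℂ H] [CompleteSpace H]
    [TopologicalSpace.SeparableSpace H]
    [NormedAddCommGroup K] [InnerProductSpace ℂ K] [CompleteSpace K]
    [TopologicalSpace.SeparableSpace K]
    (hH : ¬ FiniteDimensional ℂ H) (hK : ¬ FiniteDimensional ℂ K)
    (A : H →ₗ.[ℂ] H) (D : K →ₗ.[ℂ] K)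
    (hA : A.IsClosed) (hAd : Dense (A.domain : Set H))
    (hD : D.IsClosed) (hDd : Dense (D.domain : Set K)) :
    (∃ (B : K →ₗ.[ℂ] H) (hB : B ∈ closableOver (H := H) D),
        IsUpperSemiWeyl (upperTriangular A B D hB.2)) ↔
      IsUpperSemiFredholm A ∧
        (IsClosed (opRange D : Set K) →
          (opAlpha D < ⊤ ∧ opAlpha A + opAlpha D ≤ opBeta A + opBeta D) ∨
            (opBeta A = ⊤ ∧ opAlpha D = ⊤)) ∧
        (¬ IsClosed (opRange D : Set K) → opBeta A = ⊤) := by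
  constructor
  · rintro ⟨B, hB, hT⟩
    have hF := hT.upperSemiFredholm
    refine ⟨isUpperSemiFredholm_of_upperTriangular hA hAd hB.2 hF, fun _ => ?_, fun hDr => ?_⟩
    · by_cases hβ : opBeta A = ⊤
      · rcases eq_or_ne (opAlpha D) ⊤ with hα | hα
        · exact Or.inr ⟨hβ, hα⟩
        · exact Or.inl ⟨hα.lt_top, by simp [hβ]⟩
      · exact Or.inl (opAlpha_add_le_of_upperTriangular hB.2 hF.alpha_lt_top
          (opInd_nonpos_iff.1 hT.ind_nonpos) hβ)
    · by_contra hβ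
      exact hDr (isClosed_opRange_of_upperTriangular hB.2 hF.closed_range hβ)
  · rintro ⟨hF, hcl, hncl⟩
    by_cases hDr : IsClosed (opRange D : Set K)
    · rcases hcl hDr with ⟨hα, hle⟩ | ⟨hβ, -⟩
      · exact ⟨_, toPMap_mem_closableOver D 0,
          isUpperSemiWeyl_upperTriangular_zero hF hD hDd hDr hα hle _⟩
      · exact exists_isUpperSemiWeyl_upperTriangular_of_opBeta_eq_top hK hF hD hDd hβ
    · exact exists_isUpperSemiWeyl_upperTriangular_of_opBeta_eq_top hK hF hD hDd (hncl hDr)
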